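/- Let $n\in\mathbb N$, $0<\beta<1$, $0\le\alpha<n$, $0<\alpha+\beta<n$, and let $b\in L^1_{\rm loc}(\mathbb R^n)$ be real-valued. A Young function is a convex, left-continuous function $\Phi:[0,\infty)\to[0,\infty]$ with $\lim_{r\to0+}\Phi(r)=\Phi(0)=0$ and $\lim_{r\to\infty}\Phi(r)=\infty$; put $\Phi^{-1}(s)=\inf\{r\ge0:\Phi(r)>s\}$. We write $\Phi\in\mathcal Y$ if $0<\Phi(r)<\infty$ for all $0<r<\infty$, and $\Phi\in\nabla_2$ if for some $C>1$ one has $\Phi(r)\le\frac1{2C}\Phi(Cr)$ for all $r\ge0$. The Orlicz space $L^\Phi(\mathbb R^n)$ consists of the $f\in L^1_{\rm loc}(\mathbb R^n)$ with $\int_{\mathbb R^n}\Phi(k|f(x)|)\,dx<\infty$ for some $k>0$, with the norm $\|f\|_{L^\Phi}=\inf\{\lambda>0:\int_{\mathbb R^n}\Phi(|f(x)|/\lambda)\,dx\le1\}$. Let $$M_{b,\alpha}f(x)=\sup_{B\ni x}|B|^{-1+\frac{\alpha}{n}}\int_B|b(x)-b(y)|\,|f(y)|\,dy,$$ the supremum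 being over all balls $B\subset\mathbb R^n$ containing $x$. We say that $M_{b,\alpha}$ is bounded from $L^\Phi$ to $L^\Psi$ if there is a constant $C$ such that for all $f\in L^\Phi(\mathbb R^n)$ the function $M_{b,\alpha}f$ is finite almost everywhere, belongs to $L^\Psi(\mathbb R^n)$, and satisfies $\|M_{b,\alpha}f\|_{L^\Psi}\le C\|f\|_{L^\Phi}$. Functions being identified when they agree almost everywhere, we write $b\in\dot\Lambda_\beta(\mathbb R^n)$ if $b$ agrees almost everywhere with a function $g$ such that, for some constant $C$, $|g(x)-g(y)|\le C|x-y|^\beta$ for all $x,y\in\mathbb R^n$. Let $\Phi,\Psi$ be Young functions and $\Phi\in\mathcal Y$. 1. If $\Phi\in\nabla_2$ and there is $C>0$ with $t^{-\frac{\alpha+\beta}{n}}\Phi^{-1}(t)\le C\,\Psi^{-1}(t)$ for all $t>0$, then $b\in\dot\Lambda_\beta(\mathbb R^n)$ implies that $M_{b,\alpha}$ is bounded from $L^\Phi(\mathbb R^n)$ to $L^\Psi(\mathbb R^n)$. 2. If there is $C>0$ with $\Psi^{-1}(t)\le C\,\Phi^{-1}(t)\,t^{-\frac{\alpha+\beta}{n}}$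 for all $t>0$, and $M_{b,\alpha}$ is bounded from $L^\Phi(\mathbb R^n)$ to $L^\Psi(\mathbb R^n)$, then $b\in\dot\Lambda_\beta(\mathbb R^n)$. 3. If $\Phi\in\nabla_2$ and there are $C_1,C_2>0$ with $C_1\Phi^{-1}(t)t^{-\frac{\alpha+\beta}{n}}\le\Psi^{-1}(t)\le C_2\Phi^{-1}(t)t^{-\frac{\alpha+\beta}{n}}$ for all $t>0$, then $b\in\dot\Lambda_\beta(\mathbb R^n)$ if and only if $M_{b,\alpha}$ is bounded from $L^\Phi(\mathbb R^n)$ to $L^\Psi(\mathbb R^n)$. -/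

import Mathlib

open MeasureTheory Filter Topology
open scoped NNReal ENNReal

noncomputable section

/-- Young functions `Φ : [0,∞) → [0,∞]`: convex, left-continuous, `Φ(0+) = Φ(0) = 0`, and
`Φ(r) → ∞` as `r → ∞`. -/
structure IsYoungFunction (Φ : ℝ≥0 → ℝ≥0∞) : Prop where
  convexOn : ConvexOn ℝ≥0 Set.univ Φ
  leftContinuous : ∀ r : ℝ≥0, ContinuousWithinAt Φ (Set.Iic r) r
  map_zero : Φ 0 = 0
  tendsto_zero : Tendsto Φ (𝓝[>] 0) (𝓝 0)
  tendsto_top : Tendsto Φ atTop (𝓝 ∞)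

/-- The class `𝒴`: `0 < Φ(r) < ∞` for `0 < r < ∞` (stated for any `Φ`, used for Young functions). -/
def YoungClassY (Φ : ℝ≥0 → ℝ≥0∞) : Prop :=
  ∀ r : ℝ≥0, 0 < r → 0 < Φ r ∧ Φ r < ∞

/-- The `∇₂`-condition: `Φ(r) ≤ Φ(C r) / (2 C)` for all `r ≥ 0` and some `C > 1`. -/
def YoungNablaTwo (Φ : ℝ≥0 → ℝ≥0∞) : Prop :=
  ∃ C : ℝ≥0, 1 < C ∧ ∀ r : ℝ≥0, Φ r ≤ (1 / (2 * (C : ℝ≥0∞))) * Φ (C * r)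

/-- The generalized inverse `Φ⁻¹(s) = inf {r ≥ 0 : Φ(r) > s}` for `0 ≤ s ≤ ∞`
(with `inf ∅ = ∞`). -/
def youngInv (Φ : ℝ≥0 → ℝ≥0∞) (s : ℝ≥0∞) : ℝ≥0∞ :=
  ⨅ (r : ℝ≥0) (_ : s < Φ r), (r : ℝ≥0∞)

/-- Membership in the Orlicz space `L^Φ(ℝⁿ)`: `f` is locally integrable and
`∫ Φ(k |f|) < ∞` for some `k > 0`. -/
def MemOrlicz {n : ℕ} (Φ : ℝ≥0 → ℝ≥0∞) (f : EuclideanSpace ℝ (Fin n) → ℝ) : Prop :=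
  LocallyIntegrable f volume ∧ ∃ k : ℝ≥0, 0 < k ∧ ∫⁻ x, Φ (k * ‖f x‖₊) < ∞

/-- The Luxemburg norm `inf {lam > 0 : ∫ Φ(|f| / lam) ≤ 1}`, with `inf ∅ = ∞`. -/
def orliczNorm {n : ℕ} (Φ : ℝ≥0 → ℝ≥0∞) (f : EuclideanSpace ℝ (Fin n) → ℝ) : ℝ≥0∞ :=
  ⨅ (lam : ℝ≥0) (_ : 0 < lam) (_ : ∫⁻ x, Φ (‖f x‖₊ / lam) ≤ 1), (lam : ℝ≥0∞)

/-- The fractional maximal commutator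
`M_{b,α} f(x) = sup_{B ∋ x} |B|^{-1+α/n} ∫_B |b(x) - b(y)| |f(y)| dy`,
the supremum being over all (open) balls containing `x`; values in `[0,∞]`. -/
def fracMaxCommutator {n : ℕ} (α : ℝ) (b f : EuclideanSpace ℝ (Fin n) → ℝ)
    (x : EuclideanSpace ℝ (Fin n)) : ℝ≥0∞ :=
  ⨆ (c : EuclideanSpace ℝ (Fin n)) (r : ℝ) (_ : 0 < r) (_ : x ∈ Metric.ball c r),
    volume (Metric.ball c r) ^ (-1 + α / (n : ℝ)) *
      ∫⁻ y in Metric.ball c r, ‖b x - b y‖ₑ * ‖f y‖ₑ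

/-- Boundedness `L^Φ(ℝⁿ) → L^Ψ(ℝⁿ)` of an operator `T` with values in `[0,∞]`-valued functions:
for each `f ∈ L^Φ`, `T f` is finite almost everywhere and (the real function it thus defines)
belongs to `L^Ψ`, and `‖T f‖_{L^Ψ} ≤ C ‖f‖_{L^Φ}` with `C` independent of `f`. -/
def BoundedOrlicz {n : ℕ} (Φ Ψ : ℝ≥0 → ℝ≥0∞)
    (T : (EuclideanSpace ℝ (Fin n) → ℝ) → EuclideanSpace ℝ (Fin n) → ℝ≥0∞) : Prop :=
  ∃ C : ℝ≥0, ∀ f : EuclideanSpace ℝ (Fin n) → ℝ, MemOrlicz Φ f →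
    (∀ᵐ x, T f x < ∞) ∧
      MemOrlicz Ψ (fun x => (T f x).toReal) ∧
        orliczNorm Ψ (fun x => (T f x).toReal) ≤ C * orliczNorm Φ f

/-- Membership of (the almost-everywhere class of) `b` in the homogeneous Lipschitz space `Λ̇_β`:
`b` agrees almost everywhere with some `g` such that `|g(x) - g(y)| ≤ C |x - y|^β` for all
`x, y`. -/
def MemLipschitzSpace {n : ℕ} (β : ℝ) (b : EuclideanSpace ℝ (Fin n) → ℝ) : Prop :=
  ∃ g : EuclideanSpace ℝ (Fin n) → ℝ, b =ᵐ[volume] g ∧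
    ∃ C : ℝ, ∀ x y : EuclideanSpace ℝ (Fin n), |g x - g y| ≤ C * ‖x - y‖ ^ β

end

/-! Sufficiency. If `b` is `β`-Hölder, then `|b x - b y|` is at most a constant times `|B| ^ (β /
n)` for `x, y` in `B`, so the commutator is dominated by the fractional maximal function of order `α
+ β` (`fracMaxCommutator_le`). A Hedberg argument (`rpow_mul_setLIntegral_ball_le`) bounds the
latter at `x` by a multiple of `Ψ⁻¹(Φ(M F x))`, where `M` is the Hardy–Littlewood maximal operator
and `F` is a normalised `|f|`. Applying `Ψ` leaves `Φ(M F)`, whose integral is controlled under `∇₂`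
by `exists_majorant_hlMaximal`.

Necessity. Testing on the indicator of a ball `B` bounds the double integral of `|b x - b y|` over
`B × B` by a multiple of `|B| ^ (2 + β / n)` (`lintegral_oscillation_le`): the norm of the indicator
contributes `1 / Φ⁻¹(1/|B|)`, the integral over `B` of a function in `L^Ψ` contributes `|B|
Ψ⁻¹(1/|B|)`, and the hypothesis compares the two. Campanato's theorem
(`memLipschitzSpace_of_oscillation`) then gives the Hölder representative.

Both directions replace Hölder's inequality and the complementary Young function by the elementary
`IsYoungFunction.mul_lintegral_le`. -/

namespace IsYoungFunction

/-! ### Young functions and their generalized inverses. -/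

variable {Φ : ℝ≥0 → ℝ≥0∞}

theorem map_mul_le (hΦ : IsYoungFunction Φ) {θ : ℝ≥0} (hθ : θ ≤ 1) (r : ℝ≥0) :
    Φ (θ * r) ≤ θ * Φ r := by
  have h := hΦ.convexOn.2 (Set.mem_univ r) (Set.mem_univ 0) (zero_le (a := θ))
    (zero_le (a := 1 - θ)) (add_tsub_cancel_of_le hθ)
  simpa [hΦ.map_zero, ENNReal.smul_def] using h

theorem mono (hΦ : IsYoungFunction Φ) : Monotone Φ := by
  intro r s hrs
  rcases eq_or_ne s 0 with rfl | hs
  · simp [nonpos_iff_eq_zero.1 hrs]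
  have h1 : r / s ≤ 1 := div_le_one_of_le₀ hrs zero_le
  calc Φ r = Φ (r / s * s) := by rw [div_mul_cancel₀ _ hs]
    _ ≤ (r / s : ℝ≥0) * Φ s := hΦ.map_mul_le h1 s
    _ ≤ 1 * Φ s := by gcongr; exact_mod_cast h1
    _ = Φ s := one_mul _

/-- Substitute for Young's inequality. For `u ≤ r` the first term suffices; for `u > r` convexity
gives `Φ r ≤ (r / u) Φ u`, and the second does. -/
theorem mul_le_of_le (hΦ : IsYoungFunction Φ) {t : ℝ≥0∞} {r : ℝ≥0} (ht : t ≤ Φ r) (u : ℝ≥0) :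
    t * u ≤ r * t + r * Φ u := by
  rcases le_total u r with h | h
  · calc t * u ≤ t * r := by gcongr
      _ = r * t := mul_comm _ _
      _ ≤ _ := le_self_add
  rcases eq_or_ne u 0 with rfl | hu
  · simp
  calc t * u ≤ Φ (r / u * u) * u := by rw [div_mul_cancel₀ _ hu]; gcongr
    _ ≤ (r / u : ℝ≥0) * Φ u * u := by
      gcongr; exact hΦ.map_mul_le (div_le_one_of_le₀ h zero_le) u
    _ = ((r / u * u : ℝ≥0) : ℝ≥0∞) * Φ u := by push_cast; ring
    _ = r * Φ u := by rw [div_mul_cancel₀ _ hu]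
    _ ≤ _ := le_add_self

theorem le_youngInv (hΦ : IsYoungFunction Φ) {s : ℝ≥0∞} {r : ℝ≥0} (h : Φ r ≤ s) :
    (r : ℝ≥0∞) ≤ youngInv Φ s := by
  refine le_iInf₂ fun u hu => ?_
  by_contra! hlt
  exact absurd (hΦ.mono (ENNReal.coe_lt_coe.1 hlt).le) (not_le.2 (h.trans_lt hu))

theorem map_le_of_le_youngInv (hΦ : IsYoungFunction Φ) {s : ℝ≥0∞} {r : ℝ≥0}
    (h : (r : ℝ≥0∞) ≤ youngInv Φ s) : Φ r ≤ s := by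
  rcases eq_or_ne r 0 with rfl | hr
  · simp [hΦ.map_zero]
  -- Every `u < r` satisfies `Φ u ≤ s`; left continuity carries this to `r`.
  have hc : Tendsto Φ (𝓝[<] r) (𝓝 (Φ r)) :=
    (hΦ.leftContinuous r).mono_left (nhdsWithin_mono _ Set.Iio_subset_Iic_self)
  have : (𝓝[<] r).NeBot := nhdsLT_neBot_of_exists_lt ⟨0, pos_iff_ne_zero.2 hr⟩
  refine le_of_tendsto hc ?_
  filter_upwards [self_mem_nhdsWithin] with u hu
  by_contra! hlt
  have h2 : youngInv Φ s ≤ u := iInf₂_le u hlt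
  exact absurd (h.trans h2) (not_le.2 (ENNReal.coe_lt_coe.2 hu))

theorem exists_lt_map (hΦ : IsYoungFunction Φ) {s : ℝ≥0∞} (hs : s < ∞) : ∃ r : ℝ≥0, s < Φ r :=
  (hΦ.tendsto_top.eventually (lt_mem_nhds hs)).exists

theorem youngInv_lt_top (hΦ : IsYoungFunction Φ) {s : ℝ≥0∞} (hs : s < ∞) : youngInv Φ s < ∞ := by
  obtain ⟨r, hr⟩ := hΦ.exists_lt_map hs
  exact (iInf₂_le r hr).trans_lt ENNReal.coe_lt_top

theorem youngInv_pos (hΦ : IsYoungFunction Φ) {s : ℝ≥0∞} (hs : 0 < s) : 0 < youngInv Φ s := by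
  have h := (hΦ.tendsto_zero.eventually (gt_mem_nhds hs)).and self_mem_nhdsWithin
  obtain ⟨r, hr, hr0⟩ := h.exists
  exact (ENNReal.coe_pos.2 hr0).trans_le (hΦ.le_youngInv hr.le)

/-- With `t = 1/|B|` this bounds averages over `B` of functions of modular at most 1. Integrate
`mul_le_of_le` and take the infimum over `r` with `Φ r > t`. -/
theorem mul_lintegral_le {X : Type*} [MeasurableSpace X] (hΦ : IsYoungFunction Φ) {μ : Measure X}
    {u : X → ℝ≥0} {t : ℝ≥0} (hμ : t * μ Set.univ ≤ 1) (hu : ∫⁻ x, Φ (u x) ∂μ ≤ 1) :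
    t * ∫⁻ x, u x ∂μ ≤ 2 * youngInv Φ t := by
  unfold youngInv
  simp_rw [ENNReal.mul_iInf_of_ne two_ne_zero ENNReal.ofNat_ne_top]
  refine le_iInf₂ fun r hr => ?_
  calc t * ∫⁻ x, u x ∂μ = ∫⁻ x, t * u x ∂μ := (lintegral_const_mul' _ _ ENNReal.coe_ne_top).symm
    _ ≤ ∫⁻ x, (r * t + r * Φ (u x)) ∂μ := lintegral_mono fun x => hΦ.mul_le_of_le hr.le (u x)
    _ = r * (t * μ Set.univ) + r * ∫⁻ x, Φ (u x) ∂μ := by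
      rw [lintegral_add_left measurable_const, lintegral_const,
        lintegral_const_mul' _ _ ENNReal.coe_ne_top, mul_assoc]
    _ ≤ r * 1 + r * 1 := by gcongr
    _ = 2 * r := by ring

theorem youngInv_mono {s t : ℝ≥0∞} (h : s ≤ t) : youngInv Φ s ≤ youngInv Φ t :=
  le_iInf₂ fun r hr => iInf₂_le r (h.trans_lt hr)

theorem exists_lintegral_le_one {X : Type*} [MeasurableSpace X] (hΦ : IsYoungFunction Φ)
    {μ : Measure X} {u : X → ℝ≥0} {k : ℝ≥0} (hk : 0 < k) (h : ∫⁻ x, Φ (k * u x) ∂μ < ∞) :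
    ∃ l : ℝ≥0, 0 < l ∧ ∫⁻ x, Φ (u x / l) ∂μ ≤ 1 := by
  lift ∫⁻ x, Φ (k * u x) ∂μ to ℝ≥0 using h.ne with I hI
  have hθ : (max I 1)⁻¹ ≤ 1 := inv_le_one_of_one_le₀ (le_max_right _ _)
  have hm : (0 : ℝ≥0) < max I 1 := lt_max_of_lt_right one_pos
  refine ⟨max I 1 / k, by positivity, ?_⟩
  calc ∫⁻ x, Φ (u x / (max I 1 / k)) ∂μ
      ≤ ∫⁻ x, ((max I 1)⁻¹ : ℝ≥0) * Φ (k * u x) ∂μ := by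
        refine lintegral_mono fun x => ?_
        have : u x / (max I 1 / k) = (max I 1)⁻¹ * (k * u x) := by field_simp
        rw [this]; exact hΦ.map_mul_le hθ _
    _ = (((max I 1)⁻¹ * I : ℝ≥0) : ℝ≥0∞) := by
        rw [lintegral_const_mul' _ _ ENNReal.coe_ne_top, ← hI, ENNReal.coe_mul]
    _ ≤ 1 := by
        rw [← ENNReal.coe_one, ENNReal.coe_le_coe, inv_mul_le_iff₀ hm, mul_one]
        exact le_max_left _ _

end IsYoungFunction

/-! ### The Hardy–Littlewood maximal function and its weak type bound. -/

noncomputable section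

/-- The uncentered Hardy–Littlewood maximal function of a nonnegative function on `ℝⁿ`. -/
def hlMaximal {n : ℕ} (F : EuclideanSpace ℝ (Fin n) → ℝ≥0∞) (x : EuclideanSpace ℝ (Fin n)) :
    ℝ≥0∞ :=
  ⨆ (c : EuclideanSpace ℝ (Fin n)) (r : ℝ) (_ : 0 < r) (_ : x ∈ Metric.ball c r),
    (volume (Metric.ball c r))⁻¹ * ∫⁻ y in Metric.ball c r, F y

section maximal

variable {n : ℕ}

theorem lt_hlMaximal_iff {F : EuclideanSpace ℝ (Fin n) → ℝ≥0∞} {x : EuclideanSpace ℝ (Fin n)}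
    {l : ℝ≥0∞} : l < hlMaximal F x ↔ ∃ c r, 0 < r ∧ x ∈ Metric.ball c r ∧
      l * volume (Metric.ball c r) < ∫⁻ y in Metric.ball c r, F y := by
  simp only [hlMaximal, lt_iSup_iff, exists_prop]
  refine exists_congr fun c => exists_congr fun r => and_congr_right fun hr =>
    and_congr_right fun _ => ?_
  rw [mul_comm (volume _)⁻¹, ← div_eq_mul_inv,
    ENNReal.lt_div_iff_mul_lt (.inl (Metric.measure_ball_pos volume c hr).ne')
      (.inl measure_ball_lt_top.ne)]

theorem isOpen_lt_hlMaximal (F : EuclideanSpace ℝ (Fin n) → ℝ≥0∞) (l : ℝ≥0∞) :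
    IsOpen {x | l < hlMaximal F x} := by
  refine isOpen_iff_forall_mem_open.2 fun x hx => ?_
  obtain ⟨c, r, hr, hxr, h⟩ := lt_hlMaximal_iff.1 hx
  exact ⟨Metric.ball c r, fun y hy => lt_hlMaximal_iff.2 ⟨c, r, hr, hy, h⟩, Metric.isOpen_ball, hxr⟩

/-- Vitali covering: a disjoint subfamily whose fivefold enlargements cover everything. The radii
must be bounded for the selection. -/
theorem mul_volume_iUnion_ball_le (F : EuclideanSpace ℝ (Fin n) → ℝ≥0∞) (l : ℝ≥0∞)
    (t : Set (EuclideanSpace ℝ (Fin n) × ℝ)) (R : ℝ) (hR : ∀ p ∈ t, p.2 ≤ R)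
    (h0 : ∀ p ∈ t, 0 < p.2)
    (ht : ∀ p ∈ t, l * volume (Metric.ball p.1 p.2) ≤ ∫⁻ y in Metric.ball p.1 p.2, F y) :
    l * volume (⋃ p ∈ t, Metric.ball p.1 p.2) ≤ 5 ^ n * ∫⁻ y, F y := by
  obtain ⟨u, hut, hdisj, hcov⟩ := Vitali.exists_disjoint_subfamily_covering_enlargement_closedBall t
    (fun p => p.1) (fun p => p.2) R hR 5 (by norm_num)
  have hdisj' : u.PairwiseDisjoint fun p => Metric.ball p.1 p.2 :=
    hdisj.mono fun p => Metric.ball_subset_closedBall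
  have hu : u.Countable := hdisj'.countable_of_isOpen (fun _ _ => Metric.isOpen_ball)
    fun p hp => ⟨p.1, Metric.mem_ball_self (h0 p (hut hp))⟩
  have hsub : (⋃ p ∈ t, Metric.ball p.1 p.2) ⊆ ⋃ p ∈ u, Metric.closedBall p.1 (5 * p.2) := by
    refine Set.iUnion₂_subset fun p hp => ?_
    obtain ⟨q, hq, hpq⟩ := hcov p hp
    exact (Metric.ball_subset_closedBall.trans hpq).trans
      (Set.subset_biUnion_of_mem (u := fun q : EuclideanSpace ℝ (Fin n) × ℝ =>
        Metric.closedBall q.1 (5 * q.2)) hq)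
  have hvol : ∀ p ∈ u, volume (Metric.closedBall p.1 (5 * p.2)) =
      5 ^ n * volume (Metric.ball p.1 p.2) := by
    intro p hp
    have hp0 := h0 p (hut hp)
    rw [Measure.addHaar_closedBall _ _ (by positivity), Measure.addHaar_ball_of_pos _ _ hp0,
      mul_pow, ENNReal.ofReal_mul (by positivity), finrank_euclideanSpace_fin, mul_assoc]
    congr 1
    rw [ENNReal.ofReal_pow (by norm_num)]; norm_num
  have := hu.to_subtype
  calc l * volume (⋃ p ∈ t, Metric.ball p.1 p.2)
      ≤ l * volume (⋃ p ∈ u, Metric.closedBall p.1 (5 * p.2)) := by gcongr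
    _ ≤ l * ∑' p : u, volume (Metric.closedBall p.1.1 (5 * p.1.2)) := by
        gcongr; exact measure_biUnion_le _ hu _
    _ = 5 ^ n * ∑' p : u, l * volume (Metric.ball p.1.1 p.1.2) := by
        rw [← ENNReal.tsum_mul_left, ← ENNReal.tsum_mul_left]
        exact tsum_congr fun p => by rw [hvol p.1 p.2]; ring
    _ ≤ 5 ^ n * ∑' p : u, ∫⁻ y in Metric.ball p.1.1 p.1.2, F y := by
        gcongr with p; exact ht p.1 (hut p.2)
    _ = 5 ^ n * ∫⁻ y in ⋃ p ∈ u, Metric.ball p.1 p.2, F y := by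
        rw [lintegral_biUnion hu (fun p _ => measurableSet_ball) hdisj']
    _ ≤ 5 ^ n * ∫⁻ y, F y := by gcongr; exact Measure.restrict_le_self

/-- The weak type `(1, 1)` inequality for the Hardy–Littlewood maximal function. -/
theorem mul_volume_lt_hlMaximal_le (F : EuclideanSpace ℝ (Fin n) → ℝ≥0∞) (l : ℝ≥0∞) :
    l * volume {x | l < hlMaximal F x} ≤ 5 ^ n * ∫⁻ y, F y := by
  -- Radii are capped at `N` so that the covering argument applies; the level set is the increasing
  -- union over `N`.
  let t : ℕ → Set (EuclideanSpace ℝ (Fin n) × ℝ) := fun N =>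
    {p | 0 < p.2 ∧ p.2 ≤ N ∧ l * volume (Metric.ball p.1 p.2) < ∫⁻ y in Metric.ball p.1 p.2, F y}
  have hset : {x | l < hlMaximal F x} = ⋃ N, ⋃ p ∈ t N, Metric.ball p.1 p.2 := by
    ext x
    simp only [Set.mem_ofPred_eq, lt_hlMaximal_iff, Set.mem_iUnion, exists_prop, t, Prod.exists]
    constructor
    · rintro ⟨c, r, hr, hx, h⟩
      obtain ⟨N, hN⟩ := exists_nat_ge r
      exact ⟨N, c, r, ⟨hr, hN, h⟩, hx⟩
    · rintro ⟨N, c, r, ⟨hr, -, h⟩, hx⟩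
      exact ⟨c, r, hr, hx, h⟩
  have hmono : Monotone fun N => ⋃ p ∈ t N, Metric.ball p.1 p.2 := fun N N' h =>
    Set.biUnion_subset_biUnion_left fun p hp =>
      ⟨hp.1, hp.2.1.trans (by exact_mod_cast h), hp.2.2⟩
  rw [hset, hmono.measure_iUnion, ENNReal.mul_iSup]
  exact iSup_le fun N => mul_volume_iUnion_ball_le F l (t N) N (fun p hp => hp.2.1)
    (fun p hp => hp.1) fun p hp => hp.2.2.le

theorem hlMaximal_le_add (F : EuclideanSpace ℝ (Fin n) → ℝ≥0∞) (l : ℝ≥0∞)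
    (x : EuclideanSpace ℝ (Fin n)) :
    hlMaximal F x ≤ l + hlMaximal (fun y => if l < F y then F y else 0) x := by
  refine iSup₂_le fun c r => iSup₂_le fun hr hx => ?_
  calc (volume (Metric.ball c r))⁻¹ * ∫⁻ y in Metric.ball c r, F y
      ≤ (volume (Metric.ball c r))⁻¹ *
        ∫⁻ y in Metric.ball c r, (l + if l < F y then F y else 0) := by
        gcongr with y; split_ifs with h
        · exact le_add_self
        · simpa using h
    _ = (volume (Metric.ball c r))⁻¹ * volume (Metric.ball c r) * l +
        (volume (Metric.ball c r))⁻¹ * ∫⁻ y in Metric.ball c r, if l < F y then F y else 0 := by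
        rw [lintegral_add_left measurable_const, setLIntegral_const]; ring
    _ ≤ _ := by
        rw [ENNReal.inv_mul_cancel (Metric.measure_ball_pos volume c hr).ne'
          measure_ball_lt_top.ne, one_mul]
        gcongr
        exact le_iSup₂_of_le c r (le_iSup₂_of_le hr hx le_rfl)

/-- Truncating at height `l` costs at most `l` in the maximal function, so only the part of `F`
above `l` enters. This localisation makes the sum over levels converge later. -/
theorem mul_volume_two_mul_lt_hlMaximal_le (F : EuclideanSpace ℝ (Fin n) → ℝ≥0∞) (l : ℝ≥0∞) :
    l * volume {x | 2 * l < hlMaximal F x} ≤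
      5 ^ n * ∫⁻ y, if l < F y then F y else 0 := by
  refine le_trans ?_ (mul_volume_lt_hlMaximal_le _ l)
  refine mul_le_mul_right (measure_mono fun x hx => ?_) _
  have h := (show 2 * l < hlMaximal F x from hx).trans_le (hlMaximal_le_add F l x)
  rw [two_mul] at h
  exact lt_of_add_lt_add_left h

end maximal

end

/-! ### The modular maximal inequality under `∇₂`. -/

noncomputable section

namespace IsYoungFunction

variable {Φ : ℝ≥0 → ℝ≥0∞}

/-- Iterating `∇₂` gains `2 ^ j` over linear growth; this surplus is the source of the geometric
series below. -/
theorem pow_mul_map_le {C : ℝ≥0} (hC : 1 < C)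
    (h : ∀ r : ℝ≥0, Φ r ≤ (1 / (2 * (C : ℝ≥0∞))) * Φ (C * r)) (j : ℕ) (r : ℝ≥0) :
    (2 * (C : ℝ≥0∞)) ^ j * Φ r ≤ Φ (C ^ j * r) := by
  have h0 : (2 * (C : ℝ≥0∞)) ≠ 0 := by
    simpa using (zero_lt_one.trans hC).ne'
  have ht : (2 * (C : ℝ≥0∞)) ≠ ∞ := by finiteness
  induction j generalizing r with
  | zero => simp
  | succ j ih =>
    calc (2 * (C : ℝ≥0∞)) ^ (j + 1) * Φ r
        ≤ (2 * (C : ℝ≥0∞)) ^ (j + 1) * ((1 / (2 * (C : ℝ≥0∞))) * Φ (C * r)) := by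
          gcongr; exact h r
      _ = (2 * (C : ℝ≥0∞)) ^ j * Φ (C * r) * ((2 * (C : ℝ≥0∞)) * (2 * (C : ℝ≥0∞))⁻¹) := by
          rw [one_div]; ring
      _ ≤ Φ (C ^ (j + 1) * r) := by
          rw [ENNReal.mul_inv_cancel h0 ht, mul_one, pow_succ, mul_assoc]; exact ih _

/-- The layer-cake sum for a single value `u`. If `C ^ K < u ≤ C ^ (K + 1)`, only `k = K - j` with
`j ≥ 0` contribute, and by `∇₂` that term is at most `C Φ(2 C u) 2⁻ʲ`. -/
theorem tsum_zpow_le (hΦ : IsYoungFunction Φ) {C : ℝ≥0} (hC : 1 < C)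
    (h : ∀ r : ℝ≥0, Φ r ≤ (1 / (2 * (C : ℝ≥0∞))) * Φ (C * r)) (u : ℝ≥0) :
    ∑' k : ℤ, Φ (2 * C ^ (k + 1)) * (((C ^ k)⁻¹ : ℝ≥0) : ℝ≥0∞) *
      (if C ^ k < u then (u : ℝ≥0∞) else 0) ≤ 2 * C * Φ (2 * C * u) := by
  have hC0 : C ≠ 0 := (zero_lt_one.trans hC).ne'
  rcases eq_or_ne u 0 with rfl | hu
  · simp
  obtain ⟨K, hK, hK'⟩ := NNReal.exists_mem_Ioc_zpow hu hC
  have hinj : Function.Injective fun j : ℕ => K - (j : ℤ) := fun i j hij => by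
    simpa using hij
  rw [← hinj.tsum_eq]
  · calc ∑' j : ℕ, Φ (2 * C ^ (K - (j : ℤ) + 1)) * (((C ^ (K - (j : ℤ)))⁻¹ : ℝ≥0) : ℝ≥0∞) *
          (if C ^ (K - (j : ℤ)) < u then (u : ℝ≥0∞) else 0)
        ≤ ∑' j : ℕ, (C * Φ (2 * C * u)) * (2⁻¹ : ℝ≥0∞) ^ j := by
          refine ENNReal.tsum_le_tsum fun j => ?_
          have h1 : (((C ^ (K - (j : ℤ)))⁻¹ : ℝ≥0) : ℝ≥0∞) = (C : ℝ≥0∞) ^ j * ((C ^ K)⁻¹ : ℝ≥0) := by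
            rw [zpow_sub₀ hC0, inv_div, zpow_natCast, div_eq_mul_inv]; push_cast; rfl
          have h2 : Φ (2 * C ^ (K - (j : ℤ) + 1)) * (2 * (C : ℝ≥0∞)) ^ j ≤ Φ (2 * C * u) := by
            rw [mul_comm]
            refine (pow_mul_map_le hC h j _).trans (hΦ.mono ?_)
            have : C ^ j * (2 * C ^ (K - (j : ℤ) + 1)) = 2 * C * C ^ K := by
              rw [show K - (j : ℤ) + 1 = K + 1 - j by ring, zpow_sub₀ hC0, zpow_natCast,
                zpow_add_one₀ hC0]
              field_simp
            rw [this]; gcongr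
          have h3 : (((C ^ K)⁻¹ : ℝ≥0) : ℝ≥0∞) * u ≤ C := by
            rw [← ENNReal.coe_mul, ENNReal.coe_le_coe, inv_mul_le_iff₀ (by positivity),
              ← zpow_add_one₀ hC0]
            exact hK'
          have h4 : (2 : ℝ≥0∞) ^ j * 2⁻¹ ^ j = 1 := by
            rw [← mul_pow, ENNReal.mul_inv_cancel two_ne_zero ENNReal.ofNat_ne_top, one_pow]
          calc _ ≤ Φ (2 * C ^ (K - (j : ℤ) + 1)) * ((C : ℝ≥0∞) ^ j * ((C ^ K)⁻¹ : ℝ≥0)) * u := by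
                rw [h1]; gcongr; split_ifs <;> simp
            _ = (Φ (2 * C ^ (K - (j : ℤ) + 1)) * (C : ℝ≥0∞) ^ j * (2 ^ j * 2⁻¹ ^ j)) *
                  (((C ^ K)⁻¹ : ℝ≥0) * u) := by rw [h4]; ring
            _ = (Φ (2 * C ^ (K - (j : ℤ) + 1)) * (2 * (C : ℝ≥0∞)) ^ j) *
                  (((C ^ K)⁻¹ : ℝ≥0) * u) * 2⁻¹ ^ j := by ring
            _ ≤ Φ (2 * C * u) * C * 2⁻¹ ^ j := by gcongr
            _ = _ := by ring
      _ = 2 * C * Φ (2 * C * u) := by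
          rw [ENNReal.tsum_mul_left, ENNReal.tsum_geometric, ENNReal.one_sub_inv_two, inv_inv]
          ring
  · intro k hk
    have hku : C ^ k < u := by
      by_contra hcon
      simp [hcon] at hk
    have hlt : k < K + 1 := (zpow_lt_zpow_iff_right₀ hC).1 (hku.trans_le hK')
    exact ⟨(K - k).toNat, by
      change K - ((K - k).toNat : ℤ) = k
      rw [Int.toNat_of_nonneg (by omega)]; ring⟩

/-- Modular inequality for the Hardy–Littlewood maximal function under the `∇₂` condition. The
function `S` is a majorant of `Φ (M F)` with `∫ S ≤ K ∫ Φ (K F)`. -/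
theorem exists_majorant_hlMaximal {n : ℕ} (hΦ : IsYoungFunction Φ) (h2 : YoungNablaTwo Φ) :
    ∃ K : ℝ≥0, 1 ≤ K ∧ ∀ F : EuclideanSpace ℝ (Fin n) → ℝ≥0, AEMeasurable F volume →
      ∃ S : EuclideanSpace ℝ (Fin n) → ℝ≥0∞,
        (∀ (x : EuclideanSpace ℝ (Fin n)) (m : ℝ≥0),
          (m : ℝ≥0∞) ≤ hlMaximal (fun y => (F y : ℝ≥0∞)) x → Φ m ≤ S x) ∧
        ∫⁻ x, S x ≤ K * ∫⁻ x, Φ (K * F x) ∧ AEMeasurable S volume := by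
  obtain ⟨C, hC, h⟩ := h2
  have hC0 : C ≠ 0 := (zero_lt_one.trans hC).ne'
  have h5 : (1 : ℝ≥0) ≤ 5 ^ n := one_le_pow₀ (by norm_num)
  have hK : 2 * C ≤ 5 ^ n * (2 * C) := le_mul_of_one_le_left zero_le h5
  refine ⟨5 ^ n * (2 * C), ?_, fun F hF => ?_⟩
  · refine le_trans ?_ hK
    calc (1 : ℝ≥0) = 1 * 1 := by norm_num
      _ ≤ 2 * C := mul_le_mul one_le_two hC.le zero_le zero_le
  let M := hlMaximal (fun y => (F y : ℝ≥0∞))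
  let E : ℤ → Set (EuclideanSpace ℝ (Fin n)) := fun k => {x | 2 * ((C ^ k : ℝ≥0) : ℝ≥0∞) < M x}
  have hE : ∀ k, MeasurableSet (E k) := fun k => (isOpen_lt_hlMaximal _ _).measurableSet
  have hψ : ∀ k : ℤ, AEMeasurable (fun y => if C ^ k < F y then (F y : ℝ≥0∞) else 0) volume := by
    intro k
    have : Measurable fun u : ℝ≥0 => if C ^ k < u then (u : ℝ≥0∞) else 0 :=
      Measurable.ite measurableSet_Ioi measurable_coe_nnreal_ennreal measurable_const
    exact this.comp_aemeasurable hF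
  -- The level with `2 C ^ k < m ≤ 2 C ^ (k + 1)` already dominates `Φ m`. Summing all levels also
  -- makes sense where the maximal function is infinite.
  refine ⟨fun x => ∑' k : ℤ, (E k).indicator (fun _ => Φ (2 * C ^ (k + 1))) x, ?_, ?_, ?_⟩
  · intro x m hm
    rcases eq_or_ne m 0 with rfl | hm0
    · simp [hΦ.map_zero]
    obtain ⟨k, hk, hk'⟩ := NNReal.exists_mem_Ioc_zpow (x := m / 2) (by simpa using hm0) hC
    rw [lt_div_iff₀' two_pos] at hk
    rw [div_le_iff₀' two_pos] at hk'
    refine le_trans ?_ (ENNReal.le_tsum k)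
    rw [Set.indicator_of_mem]
    · exact hΦ.mono hk'
    · exact lt_of_lt_of_le (by exact_mod_cast hk) hm
  · calc ∫⁻ x, ∑' k : ℤ, (E k).indicator (fun _ => Φ (2 * C ^ (k + 1))) x
        = ∑' k : ℤ, Φ (2 * C ^ (k + 1)) * volume (E k) := by
          rw [lintegral_tsum fun k => (measurable_const.indicator (hE k)).aemeasurable]
          exact tsum_congr fun k => lintegral_indicator_const (hE k) _
      _ ≤ ∑' k : ℤ, Φ (2 * C ^ (k + 1)) * ((((C ^ k)⁻¹ : ℝ≥0) : ℝ≥0∞) *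
            (5 ^ n * ∫⁻ y, if C ^ k < F y then (F y : ℝ≥0∞) else 0)) := by
          gcongr with k
          have hw := mul_volume_two_mul_lt_hlMaximal_le (fun y => (F y : ℝ≥0∞)) (C ^ k : ℝ≥0)
          simp only [ENNReal.coe_lt_coe] at hw
          calc volume (E k)
              = (((C ^ k)⁻¹ : ℝ≥0) : ℝ≥0∞) * (((C ^ k : ℝ≥0) : ℝ≥0∞) * volume (E k)) := by
                rw [← mul_assoc, ← ENNReal.coe_mul, inv_mul_cancel₀ (by positivity),
                  ENNReal.coe_one, one_mul]
            _ ≤ _ := by gcongr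
      _ = 5 ^ n * ∫⁻ y, ∑' k : ℤ, Φ (2 * C ^ (k + 1)) * (((C ^ k)⁻¹ : ℝ≥0) : ℝ≥0∞) *
            (if C ^ k < F y then (F y : ℝ≥0∞) else 0) := by
          rw [lintegral_tsum fun k => (hψ k).const_mul _, ← ENNReal.tsum_mul_left]
          refine tsum_congr fun k => ?_
          rw [lintegral_const_mul'' _ (hψ k)]; ring
      _ ≤ 5 ^ n * ∫⁻ y, 2 * C * Φ (2 * C * F y) := by
          gcongr with y; exact hΦ.tsum_zpow_le hC h (F y)
      _ ≤ 5 ^ n * ∫⁻ y, 2 * C * Φ (5 ^ n * (2 * C) * F y) := by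
          gcongr with y; exact hΦ.mono (by gcongr)
      _ = _ := by
          rw [lintegral_const_mul' _ _ (by finiteness)]; push_cast; ring
  · exact AEMeasurable.tsum fun k => (measurable_const.indicator (hE k)).aemeasurable

end IsYoungFunction

end

/-! ### Hedberg's estimate and Orlicz space preliminaries. -/

section orlicz

variable {n : ℕ} {Φ Ψ : ℝ≥0 → ℝ≥0∞}

/-- Hedberg type estimate: fractional averages of `F` on balls containing `x` are controlled by the
Hardy–Littlewood maximal function at `x`. -/
theorem rpow_mul_setLIntegral_ball_le {p : ℝ} (hp : 0 ≤ p) (hΦ : IsYoungFunction Φ)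
    (hΦY : YoungClassY Φ) {C : ℝ≥0∞}
    (hC : ∀ t : ℝ≥0, 0 < t → (t : ℝ≥0∞) ^ (-p) * youngInv Φ t ≤ C * youngInv Ψ t)
    {F : EuclideanSpace ℝ (Fin n) → ℝ≥0} (hF : ∫⁻ y, Φ (F y) ≤ 1)
    {x c : EuclideanSpace ℝ (Fin n)} {r : ℝ} (hr : 0 < r) (hx : x ∈ Metric.ball c r) {m : ℝ≥0}
    (hm : hlMaximal (fun y => (F y : ℝ≥0∞)) x = m) :
    volume (Metric.ball c r) ^ (-1 + p) * ∫⁻ y in Metric.ball c r, F y ≤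
      2 * C * youngInv Ψ (Φ m) := by
  have hv0 : volume (Metric.ball c r) ≠ 0 := (Metric.measure_ball_pos volume c hr).ne'
  have hvt : volume (Metric.ball c r) ≠ ∞ := measure_ball_lt_top.ne
  have hAm : (volume (Metric.ball c r))⁻¹ * ∫⁻ y in Metric.ball c r, F y ≤ m := by
    rw [← hm]
    exact le_iSup₂_of_le c r (le_iSup₂_of_le hr hx le_rfl)
  rw [ENNReal.rpow_add _ _ hv0 hvt, ENNReal.rpow_neg_one, mul_comm _ (_ ^ p), mul_assoc]
  generalize hA : (volume (Metric.ball c r))⁻¹ * ∫⁻ y in Metric.ball c r, (F y : ℝ≥0∞) = A at *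
  rcases eq_or_ne m 0 with rfl | hm0
  · rw [ENNReal.coe_zero, nonpos_iff_eq_zero] at hAm
    simp [hAm]
  obtain ⟨hs0, hst⟩ := hΦY m (pos_iff_ne_zero.2 hm0)
  obtain ⟨t, ht⟩ : ∃ t : ℝ≥0, (t : ℝ≥0∞) = (volume (Metric.ball c r))⁻¹ :=
    ⟨_, ENNReal.coe_toNNReal (ENNReal.inv_ne_top.2 hv0)⟩
  have ht0 : 0 < t := by
    rw [← ENNReal.coe_pos, ht]; exact ENNReal.inv_pos.2 hvt
  have hvp : volume (Metric.ball c r) ^ p = (t : ℝ≥0∞) ^ (-p) := by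
    rw [ht, ENNReal.inv_rpow, ENNReal.rpow_neg, inv_inv]
  rw [hvp]
  have hAt : A ≤ 2 * youngInv Φ t := by
    rw [← hA, ← ht]
    refine hΦ.mul_lintegral_le ?_ ((setLIntegral_le_lintegral _ _).trans hF)
    rw [ht, Measure.restrict_apply_univ, ENNReal.inv_mul_cancel hv0 hvt]
  -- Here `t = 1/|B|`. On large balls the average is at most `2 Φ⁻¹(t)` and the hypothesis is used
  -- at `t`; on small balls it is at most `m ≤ Φ⁻¹(Φ m)` and the hypothesis is used at `Φ m`, which
  -- lies in `(0, ∞)` by the class `𝒴`.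
  rcases le_total (t : ℝ≥0∞) (Φ m) with h | h
  · calc (t : ℝ≥0∞) ^ (-p) * A ≤ t ^ (-p) * (2 * youngInv Φ t) := by gcongr
      _ = 2 * (t ^ (-p) * youngInv Φ t) := by ring
      _ ≤ 2 * (C * youngInv Ψ t) := mul_le_mul_right (hC t ht0) _
      _ ≤ 2 * (C * youngInv Ψ (Φ m)) := by gcongr; exact IsYoungFunction.youngInv_mono h
      _ = _ := by ring
  · have hmi := hΦ.le_youngInv (le_refl (Φ m))
    lift Φ m to ℝ≥0 using hst.ne with s hs
    calc (t : ℝ≥0∞) ^ (-p) * A ≤ s ^ (-p) * youngInv Φ s :=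
          mul_le_mul' (by
            rw [ENNReal.rpow_neg, ENNReal.rpow_neg]
            exact ENNReal.inv_le_inv.2 (ENNReal.rpow_le_rpow h hp)) (hAm.trans hmi)
      _ ≤ C * youngInv Ψ s := hC s (ENNReal.coe_pos.1 hs0)
      _ ≤ 2 * (C * youngInv Ψ s) := le_mul_of_one_le_left zero_le one_le_two
      _ = _ := by ring

theorem locallyIntegrable_of_lintegral_le_one (hΨ : IsYoungFunction Ψ)
    {h : EuclideanSpace ℝ (Fin n) → ℝ} (hm : AEStronglyMeasurable h volume) {l : ℝ≥0} (hl : 0 < l)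
    (hi : ∫⁻ x, Ψ (‖h x‖₊ / l) ≤ 1) : LocallyIntegrable h volume := by
  refine locallyIntegrable_iff.2 fun k hk => ⟨hm.restrict, ?_⟩
  obtain ⟨r, hr⟩ := hΨ.exists_lt_map ENNReal.one_lt_top
  have hpt : ∀ x, ‖h x‖ₑ ≤ l * r + l * r * Ψ (‖h x‖₊ / l) := fun x => by
    have h1 := hΨ.mul_le_of_le hr.le (‖h x‖₊ / l)
    rw [one_mul, mul_one] at h1
    calc ‖h x‖ₑ = l * ((‖h x‖₊ / l : ℝ≥0) : ℝ≥0∞) := by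
          rw [← ENNReal.coe_mul, mul_div_cancel₀ _ hl.ne']; rfl
      _ ≤ l * (r + r * Ψ (‖h x‖₊ / l)) := by gcongr
      _ = _ := by ring
  calc ∫⁻ x in k, ‖h x‖ₑ ≤ ∫⁻ x in k, (l * r + l * r * Ψ (‖h x‖₊ / l)) := lintegral_mono hpt
    _ = l * r * volume k + l * r * ∫⁻ x in k, Ψ (‖h x‖₊ / l) := by
      rw [lintegral_add_left measurable_const, setLIntegral_const,
        lintegral_const_mul' _ _ (by finiteness)]
    _ ≤ l * r * volume k + l * r * 1 := by
      gcongr; exact (setLIntegral_le_lintegral _ _).trans hi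
    _ < ∞ := by
      have := hk.measure_lt_top (μ := (volume : Measure (EuclideanSpace ℝ (Fin n))))
      finiteness

theorem orliczNorm_le {h : EuclideanSpace ℝ (Fin n) → ℝ} {l : ℝ≥0} (hl : 0 < l)
    (hi : ∫⁻ x, Φ (‖h x‖₊ / l) ≤ 1) : orliczNorm Φ h ≤ l :=
  iInf_le_of_le l (iInf₂_le hl hi)

end orlicz

/-! ### The commutator with a Hölder symbol. -/

section commutator

variable {n : ℕ}

theorem fracMaxCommutator_ae_congr {α : ℝ} {b g : EuclideanSpace ℝ (Fin n) → ℝ}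
    (h : b =ᵐ[volume] g) (f : EuclideanSpace ℝ (Fin n) → ℝ) :
    fracMaxCommutator α b f =ᵐ[volume] fracMaxCommutator α g f := by
  filter_upwards [h] with x hx
  refine iSup_congr fun c => iSup_congr fun r => iSup_congr fun hr => iSup_congr fun hxr => ?_
  congr 1
  refine lintegral_congr_ae ?_
  filter_upwards [ae_restrict_of_ae h] with y hy
  rw [hx, hy]

/-- Serves measurability. For a fixed ball the average varies continuously with `x`, since `g` is
continuous and `f` is integrable on the ball; a supremum of such functions over open balls is lower
semicontinuous. -/
theorem lowerSemicontinuous_fracMaxCommutator {α : ℝ} {g f : EuclideanSpace ℝ (Fin n) → ℝ}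
    (hg : Continuous g) (hf : LocallyIntegrable f volume) :
    LowerSemicontinuous (fracMaxCommutator α g f) := by
  intro x l hl
  simp only [fracMaxCommutator, lt_iSup_iff] at hl
  obtain ⟨c, r, hr, hx, hl⟩ := hl
  set w := volume (Metric.ball c r) ^ (-1 + α / (n : ℝ)) with hw
  have hwt : w ≠ ∞ := ENNReal.rpow_ne_top_of_ne_zero (Metric.measure_ball_pos volume c hr).ne'
    measure_ball_lt_top.ne
  have hI : ∫⁻ y in Metric.ball c r, ‖f y‖ₑ ≠ ∞ :=
    (((hf.integrableOn_isCompact (isCompact_closedBall c r)).mono_set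
      Metric.ball_subset_closedBall).2).ne
  set I := ∫⁻ y in Metric.ball c r, ‖f y‖ₑ
  have hfm : AEMeasurable (fun y => ‖f y‖ₑ) (volume.restrict (Metric.ball c r)) :=
    hf.aestronglyMeasurable.restrict.enorm
  have key : ∀ x', w * ∫⁻ y in Metric.ball c r, ‖g x - g y‖ₑ * ‖f y‖ₑ ≤
      w * (∫⁻ y in Metric.ball c r, ‖g x' - g y‖ₑ * ‖f y‖ₑ) + ‖g x - g x'‖ₑ * (w * I) := by
    intro x'
    calc w * ∫⁻ y in Metric.ball c r, ‖g x - g y‖ₑ * ‖f y‖ₑ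
        ≤ w * ∫⁻ y in Metric.ball c r, (‖g x' - g y‖ₑ * ‖f y‖ₑ + ‖g x - g x'‖ₑ * ‖f y‖ₑ) := by
          gcongr with y
          rw [← add_mul]
          gcongr
          rw [add_comm, show g x - g y = (g x - g x') + (g x' - g y) by ring]
          exact enorm_add_le _ _
      _ = _ := by
          rw [lintegral_add_right' _ (hfm.const_mul _), lintegral_const_mul'' _ hfm]; ring
  have hlim : Tendsto (fun x' => l + ‖g x - g x'‖ₑ * (w * I)) (𝓝 x) (𝓝 l) := by
    have h1 : Tendsto (fun x' => ‖g x - g x'‖ₑ) (𝓝 x) (𝓝 0) := by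
      have : Continuous fun x' => ‖g x - g x'‖ₑ := by fun_prop
      simpa using this.tendsto x
    have h2 := ENNReal.Tendsto.mul_const (b := w * I) h1 (.inr (by finiteness))
    simpa using h2.const_add l
  have hball : ∀ᶠ x' in 𝓝 x, x' ∈ Metric.ball c r := Metric.isOpen_ball.mem_nhds hx
  filter_upwards [hlim.eventually (gt_mem_nhds hl), hball] with x' h1 hx'
  have h2 : l < w * ∫⁻ y in Metric.ball c r, ‖g x' - g y‖ₑ * ‖f y‖ₑ := by
    by_contra! hcon
    exact absurd ((key x').trans (add_le_add_left hcon _)) (not_le.2 h1)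
  refine h2.trans_le ?_
  unfold fracMaxCommutator
  exact le_iSup₂_of_le c r (le_iSup₂_of_le hr hx' le_rfl)

theorem aemeasurable_fracMaxCommutator {α : ℝ} {b g f : EuclideanSpace ℝ (Fin n) → ℝ}
    (hbg : b =ᵐ[volume] g) (hg : Continuous g) (hf : LocallyIntegrable f volume) :
    AEMeasurable (fracMaxCommutator α b f) volume :=
  ⟨_, (lowerSemicontinuous_fracMaxCommutator hg hf).measurable, fracMaxCommutator_ae_congr hbg f⟩

theorem continuous_of_abs_sub_le_rpow {β C : ℝ} (hβ : 0 < β) {g : EuclideanSpace ℝ (Fin n) → ℝ}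
    (h : ∀ x y, |g x - g y| ≤ C * ‖x - y‖ ^ β) : Continuous g := by
  refine continuous_iff_continuousAt.2 fun x => ?_
  rw [ContinuousAt, tendsto_iff_norm_sub_tendsto_zero]
  refine squeeze_zero (fun _ => norm_nonneg _) (fun y => h y x) ?_
  have : Continuous fun y : EuclideanSpace ℝ (Fin n) => C * ‖y - x‖ ^ β :=
    continuous_const.mul ((continuous_id.sub continuous_const).norm.rpow_const
      fun _ => .inr hβ.le)
  simpa [Real.zero_rpow hβ.ne'] using this.tendsto x

/-- On a ball of radius `r`, a `β`-Hölder function oscillates by at most a constant times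
`|B| ^ (β / n)`. -/
theorem exists_enorm_sub_le_volume_rpow (hn : 0 < n) {β C : ℝ} (hβ : 0 < β)
    {g : EuclideanSpace ℝ (Fin n) → ℝ} (h : ∀ x y, |g x - g y| ≤ C * ‖x - y‖ ^ β) :
    ∃ H : ℝ≥0, 0 < H ∧ ∀ (c : EuclideanSpace ℝ (Fin n)) (r : ℝ), 0 < r →
      ∀ x ∈ Metric.ball c r, ∀ y ∈ Metric.ball c r,
        ‖g x - g y‖ₑ ≤ H * volume (Metric.ball c r) ^ (β / n) := by
  set ω := volume (Metric.ball (0 : EuclideanSpace ℝ (Fin n)) 1) with hω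
  have hω0 : ω ≠ 0 := (Metric.measure_ball_pos volume _ one_pos).ne'
  have hωt : ω ≠ ∞ := measure_ball_lt_top.ne
  -- The factor `2 ^ β` comes from the diameter `2 r`; the maximum ensures positivity, as `C` has no
  -- prescribed sign.
  set D : ℝ := max C 1 * 2 ^ β with hD
  have hD0 : 0 < D := by positivity
  have hH0 : ENNReal.ofReal D * ω ^ (-(β / n)) ≠ 0 :=
    mul_ne_zero (by simpa using hD0) (ENNReal.rpow_pos (pos_iff_ne_zero.2 hω0) hωt).ne'
  have hHt : ENNReal.ofReal D * ω ^ (-(β / n)) ≠ ∞ :=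
    ENNReal.mul_ne_top ENNReal.ofReal_ne_top (ENNReal.rpow_ne_top_of_ne_zero hω0 hωt)
  refine ⟨(ENNReal.ofReal D * ω ^ (-(β / n))).toNNReal, ENNReal.toNNReal_pos hH0 hHt,
    fun c r hr x hx y hy => ?_⟩
  rw [ENNReal.coe_toNNReal hHt, Measure.addHaar_ball_of_pos _ _ hr, finrank_euclideanSpace_fin,
    ENNReal.mul_rpow_of_nonneg _ _ (by positivity), ← hω,
    ENNReal.ofReal_rpow_of_nonneg (by positivity) (by positivity), ← Real.rpow_natCast,
    ← Real.rpow_mul hr.le, mul_div_cancel₀ _ (by positivity)]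
  have hxy : ‖x - y‖ ≤ 2 * r := by
    rw [← dist_eq_norm]
    linarith [dist_triangle_right x y c, Metric.mem_ball.1 hx, Metric.mem_ball.1 hy]
  calc ‖g x - g y‖ₑ = ENNReal.ofReal |g x - g y| := Real.enorm_eq_ofReal_abs _
    _ ≤ ENNReal.ofReal (D * r ^ β) := by
      refine ENNReal.ofReal_le_ofReal ((h x y).trans ?_)
      calc C * ‖x - y‖ ^ β ≤ max C 1 * (2 * r) ^ β := by
            gcongr
            exact le_max_left _ _
        _ = D * r ^ β := by rw [Real.mul_rpow zero_le_two hr.le, hD]; ring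
    _ = ENNReal.ofReal D * ENNReal.ofReal (r ^ β) * (ω ^ (-(β / n)) * ω ^ (β / n)) := by
      rw [← ENNReal.rpow_add _ _ hω0 hωt, neg_add_cancel, ENNReal.rpow_zero, mul_one,
        ENNReal.ofReal_mul hD0.le]
    _ = _ := by ring

theorem fracMaxCommutator_le {α β : ℝ} {b f : EuclideanSpace ℝ (Fin n) → ℝ}
    {g : EuclideanSpace ℝ (Fin n) → ℝ} (hbg : b =ᵐ[volume] g) {H : ℝ≥0}
    (hH : ∀ (c : EuclideanSpace ℝ (Fin n)) (r : ℝ), 0 < r →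
      ∀ x ∈ Metric.ball c r, ∀ y ∈ Metric.ball c r,
        ‖g x - g y‖ₑ ≤ H * volume (Metric.ball c r) ^ (β / n))
    {x : EuclideanSpace ℝ (Fin n)} (hx : b x = g x) {A : ℝ≥0∞}
    (hA : ∀ (c : EuclideanSpace ℝ (Fin n)) (r : ℝ), 0 < r → x ∈ Metric.ball c r →
      volume (Metric.ball c r) ^ (-1 + (α + β) / n) * ∫⁻ y in Metric.ball c r, ‖f y‖ₑ ≤ A) :
    fracMaxCommutator α b f x ≤ H * A := by
  refine iSup₂_le fun c r => iSup₂_le fun hr hxr => ?_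
  have hv0 : volume (Metric.ball c r) ≠ 0 := (Metric.measure_ball_pos volume c hr).ne'
  have hvt : volume (Metric.ball c r) ≠ ∞ := measure_ball_lt_top.ne
  set v := volume (Metric.ball c r)
  have hvp : v ^ (β / n) ≠ ∞ := ENNReal.rpow_ne_top_of_ne_zero hv0 hvt
  calc v ^ (-1 + α / n) * ∫⁻ y in Metric.ball c r, ‖b x - b y‖ₑ * ‖f y‖ₑ
      ≤ v ^ (-1 + α / n) * ∫⁻ y in Metric.ball c r, H * v ^ (β / n) * ‖f y‖ₑ := by
        refine mul_le_mul_right (lintegral_mono_ae ?_) _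
        filter_upwards [ae_restrict_of_ae hbg, ae_restrict_mem measurableSet_ball] with y hy hyr
        rw [hx, hy]
        gcongr
        exact hH c r hr x hxr y hyr
    _ = H * (v ^ (-1 + (α + β) / n) * ∫⁻ y in Metric.ball c r, ‖f y‖ₑ) := by
        rw [lintegral_const_mul' _ _ (by finiteness),
          show (-1 + (α + β) / n : ℝ) = (-1 + α / n) + β / n by ring,
          ENNReal.rpow_add (-1 + α / n : ℝ) _ hv0 hvt]
        ring
    _ ≤ H * A := by gcongr; exact hA c r hr hxr

end commutator

theorem lintegral_fracMaxCommutator_le_one {n : ℕ} (hn : 0 < n) {α β : ℝ} (hαβ₀ : 0 < α + β)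
    {b g : EuclideanSpace ℝ (Fin n) → ℝ} {Φ Ψ : ℝ≥0 → ℝ≥0∞} (hΦ : IsYoungFunction Φ)
    (hΨ : IsYoungFunction Ψ) (hΦY : YoungClassY Φ) (h2 : YoungNablaTwo Φ) {C : ℝ≥0} (hC0 : 0 < C)
    (hC : ∀ t : ℝ≥0, 0 < t →
      (t : ℝ≥0∞) ^ (-((α + β) / (n : ℝ))) * youngInv Φ t ≤ C * youngInv Ψ t)
    (hbg : b =ᵐ[volume] g) {H : ℝ≥0} (hH0 : 0 < H)
    (hH : ∀ (c : EuclideanSpace ℝ (Fin n)) (r : ℝ), 0 < r →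
      ∀ x ∈ Metric.ball c r, ∀ y ∈ Metric.ball c r,
        ‖g x - g y‖ₑ ≤ H * volume (Metric.ball c r) ^ (β / n)) :
    ∃ D : ℝ≥0, 0 < D ∧ ∀ f : EuclideanSpace ℝ (Fin n) → ℝ, AEStronglyMeasurable f volume →
      ∀ l : ℝ≥0, 0 < l → ∫⁻ x, Φ (‖f x‖₊ / l) ≤ 1 →
        (∀ᵐ x, fracMaxCommutator α b f x < ∞) ∧
          ∫⁻ x, Ψ (‖(fracMaxCommutator α b f x).toReal‖₊ / (D * l)) ≤ 1 := by
  obtain ⟨K, hK1, hK⟩ := hΦ.exists_majorant_hlMaximal (n := n) h2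
  have hK0 : 0 < K := zero_lt_one.trans_le hK1
  refine ⟨H * K ^ 2 * 2 * C, by positivity, fun f hf l hl hfl => ?_⟩
  -- One factor `K` undoes the dilation inside `Φ (K * F)`; the other, by convexity, yields the
  -- `K⁻¹` that cancels the outer constant of the modular inequality.
  set F : EuclideanSpace ℝ (Fin n) → ℝ≥0 := fun y => ‖f y‖₊ / (l * K ^ 2) with hFdef
  have hFm : AEMeasurable F volume := hf.nnnorm.aemeasurable.div_const _
  obtain ⟨S, hS, hSi, hSm⟩ := hK F hFm
  have hKinv : K⁻¹ ≤ 1 := inv_le_one_of_one_le₀ hK1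
  have hKF : ∫⁻ y, Φ (K * F y) ≤ (K⁻¹ : ℝ≥0) := by
    calc ∫⁻ y, Φ (K * F y) ≤ ∫⁻ y, (K⁻¹ : ℝ≥0) * Φ (‖f y‖₊ / l) := by
          refine lintegral_mono fun y => ?_
          have : K * F y = K⁻¹ * (‖f y‖₊ / l) := by simp only [hFdef]; field_simp
          rw [this]; exact hΦ.map_mul_le hKinv _
      _ = (K⁻¹ : ℝ≥0) * ∫⁻ y, Φ (‖f y‖₊ / l) := lintegral_const_mul' _ _ ENNReal.coe_ne_top
      _ ≤ (K⁻¹ : ℝ≥0) * 1 := by gcongr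
      _ = _ := mul_one _
  have hF1 : ∫⁻ y, Φ (F y) ≤ 1 :=
    (lintegral_mono fun y => hΦ.mono (le_mul_of_one_le_left zero_le hK1)).trans
      (hKF.trans (by exact_mod_cast hKinv))
  have hS1 : ∫⁻ x, S x ≤ 1 := by
    calc ∫⁻ x, S x ≤ K * ∫⁻ x, Φ (K * F x) := hSi
      _ ≤ K * (K⁻¹ : ℝ≥0) := by gcongr
      _ = 1 := by rw [← ENNReal.coe_mul, mul_inv_cancel₀ hK0.ne', ENNReal.coe_one]
  have hSt : ∀ᵐ x, S x < ∞ := ae_lt_top' hSm (hS1.trans_lt ENNReal.one_lt_top).ne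
  have key : ∀ᵐ x, fracMaxCommutator α b f x < ∞ ∧
      Ψ (‖(fracMaxCommutator α b f x).toReal‖₊ / (H * K ^ 2 * 2 * C * l)) ≤ S x := by
    filter_upwards [hSt, hbg] with x hxS hxb
    -- An infinite maximal function would force `Φ r ≤ S x < ∞` for every `r`, against `Φ → ∞`.
    have hmt : hlMaximal (fun y => (F y : ℝ≥0∞)) x ≠ ∞ := by
      intro htop
      obtain ⟨r, hr⟩ := hΦ.exists_lt_map hxS
      exact absurd (hS x r (by rw [htop]; exact le_top)) (not_le.2 hr)
    obtain ⟨m, hm⟩ : ∃ m : ℝ≥0, hlMaximal (fun y => (F y : ℝ≥0∞)) x = m :=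
      ⟨_, (ENNReal.coe_toNNReal hmt).symm⟩
    have hmS : Φ m ≤ S x := hS x m hm.ge
    have hT : fracMaxCommutator α b f x ≤
        H * ((l * K ^ 2 : ℝ≥0) * (2 * C * youngInv Ψ (Φ m))) := by
      refine fracMaxCommutator_le hbg hH hxb fun c r hr hxr => ?_
      have hfF : ∀ y, ‖f y‖ₑ = (l * K ^ 2 : ℝ≥0) * (F y : ℝ≥0∞) := fun y => by
        rw [← ENNReal.coe_mul, hFdef]
        simp only
        rw [mul_div_cancel₀ _ (by positivity)]; rfl
      simp_rw [hfF]
      rw [lintegral_const_mul' _ _ ENNReal.coe_ne_top, mul_left_comm]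
      refine mul_le_mul_right ?_ _
      exact rpow_mul_setLIntegral_ball_le (by positivity) hΦ hΦY hC hF1 hr hxr hm
    have hy : youngInv Ψ (Φ m) < ∞ := hΨ.youngInv_lt_top (hmS.trans_lt hxS)
    have hTt : fracMaxCommutator α b f x < ∞ := hT.trans_lt (by finiteness)
    refine ⟨hTt, (hΨ.map_le_of_le_youngInv ?_).trans hmS⟩
    have hD : (0 : ℝ≥0) < H * K ^ 2 * 2 * C * l := by positivity
    rw [ENNReal.coe_div hD.ne']
    refine ENNReal.div_le_of_le_mul ?_
    have : ((‖(fracMaxCommutator α b f x).toReal‖₊ : ℝ≥0) : ℝ≥0∞) = fracMaxCommutator α b f x := by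
      rw [← enorm_eq_nnnorm, Real.enorm_of_nonneg ENNReal.toReal_nonneg,
        ENNReal.ofReal_toReal hTt.ne]
    rw [this]
    refine hT.trans (le_of_eq ?_)
    push_cast; ring
  exact ⟨key.mono fun x hx => hx.1, (lintegral_mono_ae (key.mono fun x hx => hx.2)).trans hS1⟩

theorem boundedOrlicz_fracMaxCommutator {n : ℕ} (hn : 0 < n) {α β : ℝ} (hβ : 0 < β)
    (hαβ₀ : 0 < α + β)
    {b : EuclideanSpace ℝ (Fin n) → ℝ} {Φ Ψ : ℝ≥0 → ℝ≥0∞} (hΦ : IsYoungFunction Φ)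
    (hΨ : IsYoungFunction Ψ) (hΦY : YoungClassY Φ) (h2 : YoungNablaTwo Φ) {C : ℝ≥0} (hC0 : 0 < C)
    (hC : ∀ t : ℝ≥0, 0 < t →
      (t : ℝ≥0∞) ^ (-((α + β) / (n : ℝ))) * youngInv Φ t ≤ C * youngInv Ψ t)
    (hb : MemLipschitzSpace β b) : BoundedOrlicz Φ Ψ (fracMaxCommutator α b) := by
  obtain ⟨g, hbg, B, hB⟩ := hb
  obtain ⟨H, hH0, hH⟩ := exists_enorm_sub_le_volume_rpow hn hβ hB
  obtain ⟨D, hD0, hD⟩ := lintegral_fracMaxCommutator_le_one hn hαβ₀ hΦ hΨ hΦY h2 hC0 hC hbg hH0 hH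
  refine ⟨D, fun f hf => ?_⟩
  have hfm := hf.1.aestronglyMeasurable
  obtain ⟨k, hk, hfk⟩ := hf.2
  obtain ⟨l, hl, hfl⟩ := hΦ.exists_lintegral_le_one hk hfk
  obtain ⟨hfin, hint⟩ := hD f hfm l hl hfl
  have hTm : AEStronglyMeasurable (fun x => (fracMaxCommutator α b f x).toReal) volume :=
    (aemeasurable_fracMaxCommutator hbg (continuous_of_abs_sub_le_rpow hβ hB)
      hf.1).ennreal_toReal.aestronglyMeasurable
  refine ⟨hfin, ⟨locallyIntegrable_of_lintegral_le_one hΨ hTm (by positivity) hint,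
    (D * l)⁻¹, by positivity, ?_⟩, ?_⟩
  · refine lt_of_le_of_lt ?_ ENNReal.one_lt_top
    simpa only [div_eq_inv_mul] using hint
  · have hD' : (D : ℝ≥0∞) ≠ 0 := by simpa using hD0.ne'
    rw [mul_comm, ← ENNReal.div_le_iff_le_mul (.inl hD') (.inl ENNReal.coe_ne_top)]
    refine le_iInf fun l => le_iInf₂ fun hl hfl => ?_
    rw [ENNReal.div_le_iff_le_mul (.inl hD') (.inl ENNReal.coe_ne_top)]
    have := orliczNorm_le (by positivity) (hD f hfm l hl hfl).2
    rw [mul_comm]; exact_mod_cast this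

/-! ### Ball averages and Campanato's theorem. -/

theorem enorm_sub_setAverage_le {X : Type*} [MeasurableSpace X] {μ : Measure X} {f : X → ℝ}
    {t : Set X} (ht0 : μ t ≠ 0) (ht : μ t ≠ ∞) (hf : IntegrableOn f t μ) (a : ℝ) :
    ‖a - ⨍ y in t, f y ∂μ‖ₑ ≤ (μ t)⁻¹ * ∫⁻ y in t, ‖a - f y‖ₑ ∂μ := by
  have hr : μ.real t ≠ 0 := (measureReal_ne_zero_iff ht).2 ht0
  have : IsFiniteMeasure (μ.restrict t) := ⟨by simpa using ht.lt_top⟩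
  have h1 : a - ⨍ y in t, f y ∂μ = (μ.real t)⁻¹ • ∫ y in t, (a - f y) ∂μ := by
    rw [integral_sub (integrable_const a) hf, setAverage_eq, setIntegral_const, smul_sub, smul_smul,
      inv_mul_cancel₀ hr, one_smul]
  rw [h1, enorm_smul]
  gcongr
  · rw [enorm_inv hr, measureReal_def, Real.enorm_of_nonneg ENNReal.toReal_nonneg,
      ENNReal.ofReal_toReal ht]
  · exact enorm_integral_le_lintegral_enorm _

theorem enorm_setAverage_sub_setAverage_le {X : Type*} [MeasurableSpace X] {μ : Measure X}
    {f : X → ℝ} {s t : Set X} (hs0 : μ s ≠ 0) (hs : μ s ≠ ∞) (ht0 : μ t ≠ 0) (ht : μ t ≠ ∞)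
    (hfs : IntegrableOn f s μ) (hft : IntegrableOn f t μ) :
    ‖(⨍ y in s, f y ∂μ) - ⨍ y in t, f y ∂μ‖ₑ ≤
      (μ s)⁻¹ * (μ t)⁻¹ * ∫⁻ x in s, ∫⁻ y in t, ‖f x - f y‖ₑ ∂μ ∂μ := by
  rw [enorm_sub_rev, mul_assoc]
  refine (enorm_sub_setAverage_le hs0 hs hfs _).trans ?_
  gcongr
  rw [← lintegral_const_mul' _ _ (ENNReal.inv_ne_top.2 ht0)]
  gcongr with x
  rw [enorm_sub_rev]
  exact enorm_sub_setAverage_le ht0 ht hft _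

section campanato

variable {n : ℕ}

theorem exists_abs_average_sub_average_le {β : ℝ} {b : EuclideanSpace ℝ (Fin n) → ℝ}
    (hn : 0 < n) (hb : LocallyIntegrable b volume) {D : ℝ≥0}
    (hD : ∀ (c : EuclideanSpace ℝ (Fin n)) (r : ℝ), 0 < r →
      ∫⁻ x in Metric.ball c r, ∫⁻ y in Metric.ball c r, ‖b x - b y‖ₑ ≤
        D * volume (Metric.ball c r) ^ (2 + β / n)) :
    ∃ A : ℝ, 0 ≤ A ∧ ∀ (c₁ c₂ : EuclideanSpace ℝ (Fin n)) (r₁ r₂ : ℝ), 0 < r₁ → 0 < r₂ →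
      Metric.closedBall c₁ r₁ ⊆ Metric.closedBall c₂ r₂ →
      |(⨍ y in Metric.closedBall c₁ r₁, b y) - ⨍ y in Metric.closedBall c₂ r₂, b y| ≤
        A * (r₂ / r₁) ^ n * r₂ ^ β := by
  set ω := volume (Metric.ball (0 : EuclideanSpace ℝ (Fin n)) 1) with hω
  have hω0 : ω ≠ 0 := (Metric.measure_ball_pos volume _ one_pos).ne'
  have hωt : ω ≠ ∞ := measure_ball_lt_top.ne
  set w := ω.toReal with hw
  have hw0 : 0 < w := ENNReal.toReal_pos hω0 hωt
  have hωw : ω = ENNReal.ofReal w := (ENNReal.ofReal_toReal hωt).symm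
  refine ⟨D * (2 ^ n * w) ^ (2 + β / n : ℝ) / w ^ 2, by positivity,
    fun c₁ c₂ r₁ r₂ h₁ h₂ hsub => ?_⟩
  have hvol : ∀ (c : EuclideanSpace ℝ (Fin n)) (r : ℝ), 0 < r →
      volume (Metric.closedBall c r) = ENNReal.ofReal (r ^ n * w) := fun c r hr => by
    rw [Measure.addHaar_closedBall _ _ hr.le, finrank_euclideanSpace_fin, ← hω, hωw,
      ENNReal.ofReal_mul (by positivity)]
  have hvol2 : volume (Metric.ball c₂ (2 * r₂)) = ENNReal.ofReal (r₂ ^ n * (2 ^ n * w)) := by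
    rw [Measure.addHaar_ball_of_pos _ _ (by positivity), finrank_euclideanSpace_fin, ← hω, hωw,
      ← ENNReal.ofReal_mul (by positivity)]
    ring_nf
  have hint : ∀ (c : EuclideanSpace ℝ (Fin n)) (r : ℝ), IntegrableOn b (Metric.closedBall c r) :=
    fun c r => hb.integrableOn_isCompact (isCompact_closedBall c r)
  have hne : ∀ (c : EuclideanSpace ℝ (Fin n)) (r : ℝ), 0 < r →
      volume (Metric.closedBall c r) ≠ 0 := fun c r hr =>
    (Metric.measure_closedBall_pos volume c hr).ne'
  have hnt : ∀ (c : EuclideanSpace ℝ (Fin n)) (r : ℝ),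
      volume (Metric.closedBall c r) ≠ ∞ := fun c r => measure_closedBall_lt_top.ne
  -- One open ball contains both closed balls, so `hD` applies to it; `(r₂ / r₁) ^ n` is the ratio
  -- of the two volumes.
  have hball : Metric.closedBall c₂ r₂ ⊆ Metric.ball c₂ (2 * r₂) :=
    Metric.closedBall_subset_ball (by linarith)
  have hpow : (r₂ ^ n) ^ (2 + β / n : ℝ) = r₂ ^ n * r₂ ^ n * r₂ ^ β := by
    rw [Real.rpow_add (by positivity), ← Real.rpow_natCast r₂ n, ← Real.rpow_mul h₂.le,
      ← Real.rpow_mul h₂.le, mul_div_cancel₀ _ (by positivity), mul_two,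
      Real.rpow_add h₂]
  have main : ‖(⨍ y in Metric.closedBall c₁ r₁, b y) - ⨍ y in Metric.closedBall c₂ r₂, b y‖ₑ ≤
      ENNReal.ofReal (D * (2 ^ n * w) ^ (2 + β / n : ℝ) / w ^ 2 * (r₂ / r₁) ^ n * r₂ ^ β) := by
    calc _ ≤ (volume (Metric.closedBall c₁ r₁))⁻¹ * (volume (Metric.closedBall c₂ r₂))⁻¹ *
          ∫⁻ x in Metric.closedBall c₁ r₁, ∫⁻ y in Metric.closedBall c₂ r₂, ‖b x - b y‖ₑ :=
          enorm_setAverage_sub_setAverage_le (hne _ _ h₁) (hnt _ _) (hne _ _ h₂) (hnt _ _)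
            (hint _ _) (hint _ _)
      _ ≤ (volume (Metric.closedBall c₁ r₁))⁻¹ * (volume (Metric.closedBall c₂ r₂))⁻¹ *
          ∫⁻ x in Metric.ball c₂ (2 * r₂), ∫⁻ y in Metric.ball c₂ (2 * r₂), ‖b x - b y‖ₑ := by
          refine mul_le_mul_right ((lintegral_mono_set (hsub.trans hball)).trans ?_) _
          exact lintegral_mono fun x => lintegral_mono_set hball
      _ ≤ (volume (Metric.closedBall c₁ r₁))⁻¹ * (volume (Metric.closedBall c₂ r₂))⁻¹ *
          (D * volume (Metric.ball c₂ (2 * r₂)) ^ (2 + β / n)) :=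
          mul_le_mul_right (hD _ _ (by positivity)) _
      _ = _ := by
          rw [hvol _ _ h₁, hvol _ _ h₂, hvol2,
            ENNReal.ofReal_rpow_of_pos (by positivity), ← ENNReal.ofReal_inv_of_pos (by positivity),
            ← ENNReal.ofReal_inv_of_pos (by positivity), ← ENNReal.ofReal_mul (by positivity),
            ← ENNReal.ofReal_coe_nnreal, ← ENNReal.ofReal_mul (by positivity),
            ← ENNReal.ofReal_mul (by positivity), Real.mul_rpow (by positivity) (by positivity),
            hpow]
          congr 1
          rw [div_pow]
          field_simp
  rw [Real.enorm_eq_ofReal_abs] at main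
  exact (ENNReal.ofReal_le_ofReal_iff (by positivity)).1 main

/-- Campanato's characterisation of Hölder functions: a locally integrable function whose mean
oscillation on each ball is at most a constant times `|B| ^ (β / n)` is Hölder. -/
theorem memLipschitzSpace_of_oscillation {β : ℝ} {b : EuclideanSpace ℝ (Fin n) → ℝ}
    (hn : 0 < n) (hβ : 0 < β) (hb : LocallyIntegrable b volume) {D : ℝ≥0}
    (hD : ∀ (c : EuclideanSpace ℝ (Fin n)) (r : ℝ), 0 < r →
      ∫⁻ x in Metric.ball c r, ∫⁻ y in Metric.ball c r, ‖b x - b y‖ₑ ≤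
        D * volume (Metric.ball c r) ^ (2 + β / n)) :
    MemLipschitzSpace β b := by
  obtain ⟨A, hA0, hA⟩ := exists_abs_average_sub_average_le hn hb hD
  let avg : EuclideanSpace ℝ (Fin n) → ℝ → ℝ := fun x r => ⨍ y in Metric.closedBall x r, b y
  set q : ℝ := (2 ^ β)⁻¹ with hq
  have h2β : 1 < (2 : ℝ) ^ β := Real.one_lt_rpow one_lt_two hβ
  have hq1 : q < 1 := inv_lt_one_of_one_lt₀ h2β
  have hq0 : 0 < q := by positivity
  have hscale : ∀ s : ℝ, 0 < s → ∀ k : ℕ, (s / 2 ^ k) ^ β = s ^ β * q ^ k := fun s hs k => by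
    rw [Real.div_rpow hs.le (by positivity), ← Real.rpow_natCast, ← Real.rpow_mul zero_le_two,
      mul_comm (k : ℝ), Real.rpow_mul zero_le_two, Real.rpow_natCast, hq, inv_pow, div_eq_mul_inv]
  have hstep : ∀ x s, 0 < s → ∀ k : ℕ,
      dist (avg x (s / 2 ^ k)) (avg x (s / 2 ^ (k + 1))) ≤ A * 2 ^ n * s ^ β * q ^ k := by
    intro x s hs k
    have hle : s / 2 ^ (k + 1) ≤ s / 2 ^ k := by
      gcongr <;> simp
    have h := hA x x (s / 2 ^ (k + 1)) (s / 2 ^ k) (by positivity) (by positivity)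
      (Metric.closedBall_subset_closedBall hle)
    rw [hscale s hs k, show s / 2 ^ k / (s / 2 ^ (k + 1)) = 2 by field_simp; ring] at h
    rw [dist_comm, Real.dist_eq, mul_assoc]
    exact h
  have hlim1 : ∀ x, ∃ a, Tendsto (fun k : ℕ => avg x (1 / 2 ^ k)) atTop (𝓝 a) := fun x =>
    cauchySeq_tendsto_of_complete (cauchySeq_of_le_geometric q _ hq1 (hstep x 1 one_pos))
  choose g hg using hlim1
  -- The limit does not depend on the initial radius: radii in a fixed ratio have averages differing
  -- by `O(q ^ k)`. This permits the choice `s = ‖x - y‖` below.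
  have hlim : ∀ x s, 0 < s → Tendsto (fun k : ℕ => avg x (s / 2 ^ k)) atTop (𝓝 (g x)) := by
    intro x s hs
    have hcomp : ∀ s₁ s₂ : ℝ, 0 < s₁ → s₁ ≤ s₂ →
        Tendsto (fun k : ℕ => avg x (s₁ / 2 ^ k) - avg x (s₂ / 2 ^ k)) atTop (𝓝 0) := by
      intro s₁ s₂ h₁ h₁₂
      have h₂ := h₁.trans_le h₁₂
      have hz : Tendsto (fun k : ℕ => A * (s₂ / s₁) ^ n * s₂ ^ β * q ^ k) atTop (𝓝 0) := by
        simpa using (tendsto_pow_atTop_nhds_zero_of_lt_one hq0.le hq1).const_mul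
          (A * (s₂ / s₁) ^ n * s₂ ^ β)
      refine squeeze_zero_norm (fun k => ?_) hz
      have h := hA x x (s₁ / 2 ^ k) (s₂ / 2 ^ k) (by positivity) (by positivity)
        (Metric.closedBall_subset_closedBall (by gcongr))
      rw [hscale s₂ h₂ k, div_div_div_cancel_right₀ (by positivity), ← mul_assoc] at h
      exact h
    rcases le_total s 1 with h | h
    · simpa using (hcomp s 1 hs h).add (hg x)
    · simpa using (hg x).sub (hcomp 1 s one_pos h)
  have hdist : ∀ x s, 0 < s → |avg x s - g x| ≤ A * 2 ^ n / (1 - q) * s ^ β := by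
    intro x s hs
    have h := dist_le_of_le_geometric_of_tendsto₀ q _ hq1 (hstep x s hs) (hlim x s hs)
    rw [pow_zero, div_one, Real.dist_eq] at h
    refine h.trans (le_of_eq ?_)
    ring
  -- The three summands bound, in units of `s ^ β`, the steps from `g x` to the average at `(x, s)`,
  -- then to that at `(y, 2 s)`, then to `g y`. Lebesgue differentiation identifies `g` with `b`.
  refine ⟨g, ?_, A * 2 ^ n / (1 - q) + A * 2 ^ n * 2 ^ β + A * 2 ^ n / (1 - q) * 2 ^ β,
    fun x y => ?_⟩
  · filter_upwards [IsUnifLocDoublingMeasure.ae_tendsto_average volume hb 1] with x hx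
    refine tendsto_nhds_unique (hx (fun _ : ℕ => x) (fun k : ℕ => 1 / 2 ^ k) ?_ ?_) (hg x)
    · refine tendsto_nhdsWithin_iff.2 ⟨?_, .of_forall fun k => ?_⟩
      · simpa using tendsto_pow_atTop_nhds_zero_of_lt_one (r := (2⁻¹ : ℝ)) (by norm_num)
          (by norm_num)
      · simp
    · exact .of_forall fun k => Metric.mem_closedBall_self (by positivity)
  · rcases eq_or_ne x y with rfl | hxy
    · simp [Real.zero_rpow hβ.ne']
    have hs : 0 < ‖x - y‖ := norm_pos_iff.2 (sub_ne_zero.2 hxy)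
    set s := ‖x - y‖ with hsdef
    have h1 := hdist x s hs
    have h2 := hdist y (2 * s) (by positivity)
    have h3 := hA x y s (2 * s) hs (by positivity) (Metric.closedBall_subset_closedBall' (by
      rw [dist_eq_norm]; linarith))
    rw [mul_div_cancel_right₀ _ hs.ne'] at h3
    rw [Real.mul_rpow zero_le_two hs.le] at h2 h3
    have h4 : |avg x s - avg y (2 * s)| ≤ A * 2 ^ n * (2 ^ β * s ^ β) := h3
    rw [abs_le] at *
    constructor <;> nlinarith [h1.1, h1.2, h2.1, h2.2, h4.1, h4.2]

end campanato

/-! ### Necessity by testing on balls, and the main theorem. -/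

theorem lintegral_oscillation_le {n : ℕ} {α β : ℝ} {b : EuclideanSpace ℝ (Fin n) → ℝ}
    {Φ Ψ : ℝ≥0 → ℝ≥0∞} (hΦ : IsYoungFunction Φ) (hΨ : IsYoungFunction Ψ) {C K : ℝ≥0}
    (hC : ∀ t : ℝ≥0, 0 < t →
      youngInv Ψ t ≤ C * (youngInv Φ t * (t : ℝ≥0∞) ^ (-((α + β) / (n : ℝ)))))
    (hK : ∀ f : EuclideanSpace ℝ (Fin n) → ℝ, MemOrlicz Φ f →
      (∀ᵐ x, fracMaxCommutator α b f x < ∞) ∧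
        orliczNorm Ψ (fun x => (fracMaxCommutator α b f x).toReal) ≤ K * orliczNorm Φ f)
    (c : EuclideanSpace ℝ (Fin n)) {r : ℝ} (hr : 0 < r) :
    ∫⁻ x in Metric.ball c r, ∫⁻ y in Metric.ball c r, ‖b x - b y‖ₑ ≤
      (2 * (K + 1) * C : ℝ≥0) * volume (Metric.ball c r) ^ (2 + β / n) := by
  have hv0 : volume (Metric.ball c r) ≠ 0 := (Metric.measure_ball_pos volume c hr).ne'
  have hvt : volume (Metric.ball c r) ≠ ∞ := measure_ball_lt_top.ne
  obtain ⟨t, ht⟩ : ∃ t : ℝ≥0, (t : ℝ≥0∞) = (volume (Metric.ball c r))⁻¹ :=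
    ⟨_, ENNReal.coe_toNNReal (ENNReal.inv_ne_top.2 hv0)⟩
  have ht0 : (0 : ℝ≥0∞) < t := ht ▸ ENNReal.inv_pos.2 hvt
  have htv : (t : ℝ≥0∞) * volume (Metric.ball c r) = 1 := by
    rw [ht, ENNReal.inv_mul_cancel hv0 hvt]
  set B := Metric.ball c r with hB
  obtain ⟨a, ha⟩ : ∃ a : ℝ≥0, (a : ℝ≥0∞) = youngInv Φ t :=
    ⟨_, ENNReal.coe_toNNReal (hΦ.youngInv_lt_top ENNReal.coe_lt_top).ne⟩
  have ha0 : 0 < a := by rw [← ENNReal.coe_pos, ha]; exact hΦ.youngInv_pos ht0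
  set f : EuclideanSpace ℝ (Fin n) → ℝ := B.indicator fun _ => 1 with hf
  have hfΦ : ∫⁻ x, Φ (a * ‖f x‖₊) ≤ 1 := by
    calc ∫⁻ x, Φ (a * ‖f x‖₊) = ∫⁻ x, B.indicator (fun _ => Φ a) x := by
          refine lintegral_congr fun x => ?_
          by_cases hx : x ∈ B <;> simp [hf, hx, hΦ.map_zero]
      _ = Φ a * volume B := lintegral_indicator_const measurableSet_ball _
      _ ≤ t * volume B := by gcongr; exact hΦ.map_le_of_le_youngInv ha.le
      _ = 1 := htv
  have hfm : MemOrlicz Φ f :=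
    ⟨((integrable_indicator_iff measurableSet_ball).2
      (integrableOn_const hvt)).locallyIntegrable, a, ha0, hfΦ.trans_lt ENNReal.one_lt_top⟩
  obtain ⟨hfin, hnorm⟩ := hK f hfm
  have hfn : orliczNorm Φ f ≤ (a⁻¹ : ℝ≥0) := orliczNorm_le (by positivity) (by
    simpa only [div_inv_eq_mul, mul_comm] using hfΦ)
  -- `K + 1` makes the inequality strict, so that an admissible `l` can be extracted from the
  -- infimum.
  have hlt : orliczNorm Ψ (fun x => (fracMaxCommutator α b f x).toReal) <
      ((K + 1) * a⁻¹ : ℝ≥0) := by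
    calc _ ≤ K * ((a⁻¹ : ℝ≥0) : ℝ≥0∞) := hnorm.trans (by gcongr)
      _ < _ := by
        rw [← ENNReal.coe_mul, ENNReal.coe_lt_coe]
        exact mul_lt_mul_of_pos_right (lt_add_one K) (by positivity)
  simp only [orliczNorm, iInf_lt_iff, exists_prop] at hlt
  obtain ⟨l, hl, hli, hlt⟩ := hlt
  have hT : ∫⁻ x in B, fracMaxCommutator α b f x ≤
      l * (volume B * (2 * youngInv Ψ t)) := by
    have h := hΨ.mul_lintegral_le (μ := volume.restrict B) (t := t)
      (u := fun x => ‖(fracMaxCommutator α b f x).toReal‖₊ / l)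
      (by rw [Measure.restrict_apply_univ, htv]) ((setLIntegral_le_lintegral _ _).trans hli)
    calc ∫⁻ x in B, fracMaxCommutator α b f x
        = ∫⁻ x in B, l * ((‖(fracMaxCommutator α b f x).toReal‖₊ / l : ℝ≥0) : ℝ≥0∞) := by
          refine lintegral_congr_ae (ae_restrict_of_ae (hfin.mono fun x hx => ?_))
          simp only
          rw [← ENNReal.coe_mul, mul_div_cancel₀ _ hl.ne', ← enorm_eq_nnnorm,
            Real.enorm_of_nonneg ENNReal.toReal_nonneg, ENNReal.ofReal_toReal hx.ne]
      _ = l * (volume B * (t * ∫⁻ x in B,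
            ((‖(fracMaxCommutator α b f x).toReal‖₊ / l : ℝ≥0) : ℝ≥0∞))) := by
          rw [lintegral_const_mul' _ _ ENNReal.coe_ne_top, ← mul_assoc (volume B),
            mul_comm (volume B), htv, one_mul]
      _ ≤ _ := by gcongr
  have hpt : ∀ x ∈ B, volume B ^ (-1 + α / (n : ℝ)) * ∫⁻ y in B, ‖b x - b y‖ₑ ≤
      fracMaxCommutator α b f x := by
    intro x hx
    refine le_trans (le_of_eq ?_) (le_iSup₂_of_le c r (le_iSup₂_of_le hr hx le_rfl))
    congr 1
    refine setLIntegral_congr_fun measurableSet_ball fun y hy => ?_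
    have : f y = 1 := Set.indicator_of_mem hy _
    simp [this]
  have hwt : volume B ^ (-1 + α / (n : ℝ)) ≠ ∞ := ENNReal.rpow_ne_top_of_ne_zero hv0 hvt
  have hosc : volume B ^ (-1 + α / (n : ℝ)) * ∫⁻ x in B, ∫⁻ y in B, ‖b x - b y‖ₑ ≤
      ∫⁻ x in B, fracMaxCommutator α b f x := by
    rw [← lintegral_const_mul' _ _ hwt]
    exact setLIntegral_mono' measurableSet_ball hpt
  have htp : (t : ℝ≥0∞) ^ (-((α + β) / (n : ℝ))) = volume B ^ ((α + β) / (n : ℝ)) := by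
    rw [ht, ENNReal.inv_rpow, ENNReal.rpow_neg, inv_inv]
  have haa : ((a⁻¹ : ℝ≥0) : ℝ≥0∞) * a = 1 := by
    rw [← ENNReal.coe_mul, inv_mul_cancel₀ ha0.ne', ENNReal.coe_one]
  have hexp : volume B ^ (1 - α / (n : ℝ)) * volume B ^ (-1 + α / (n : ℝ)) = 1 := by
    rw [← ENNReal.rpow_add _ _ hv0 hvt]; simp
  calc ∫⁻ x in B, ∫⁻ y in B, ‖b x - b y‖ₑ
      = volume B ^ (1 - α / (n : ℝ)) *
          (volume B ^ (-1 + α / (n : ℝ)) * ∫⁻ x in B, ∫⁻ y in B, ‖b x - b y‖ₑ) := by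
        rw [← mul_assoc, hexp, one_mul]
    _ ≤ volume B ^ (1 - α / (n : ℝ)) * (l * (volume B * (2 * youngInv Ψ t))) :=
        mul_le_mul_right (hosc.trans hT) _
    _ ≤ volume B ^ (1 - α / (n : ℝ)) * (((K + 1) * a⁻¹ : ℝ≥0) * (volume B *
          (2 * (C * (a * volume B ^ ((α + β) / (n : ℝ))))))) := by
        rw [ha, ← htp]
        gcongr
        exact hC t (ENNReal.coe_pos.1 ht0)
    _ = (((a⁻¹ : ℝ≥0) : ℝ≥0∞) * a) * ((2 * (K + 1) * C : ℝ≥0) * (volume B ^ (1 - α / (n : ℝ)) *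
          volume B ^ (1 : ℝ) * volume B ^ ((α + β) / (n : ℝ)))) := by
        rw [ENNReal.rpow_one]; push_cast; ring
    -- The exponents add up: `(1 - α/n) + 1 + (α + β)/n = 2 + β/n`.
    _ = _ := by
        rw [haa, one_mul, ← ENNReal.rpow_add _ _ hv0 hvt, ← ENNReal.rpow_add _ _ hv0 hvt]
        congr 2; ring

theorem mainTheorem2 (n : ℕ) (α β : ℝ) (hβ₀ : 0 < β) (hβ₁ : β < 1)
    (hα₀ : 0 ≤ α) (hα₁ : α < n) (hαβ₀ : 0 < α + β) (hαβ₁ : α + β < n)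
    (b : EuclideanSpace ℝ (Fin n) → ℝ) (hb : LocallyIntegrable b volume)
    (Φ Ψ : ℝ≥0 → ℝ≥0∞) (hΦ : IsYoungFunction Φ) (hΨ : IsYoungFunction Ψ)
    (hΦY : YoungClassY Φ) :
    (YoungNablaTwo Φ →
      (∃ C : ℝ≥0, 0 < C ∧ ∀ t : ℝ≥0, 0 < t →
        (t : ℝ≥0∞) ^ (-((α + β) / (n : ℝ))) * youngInv Φ t ≤ C * youngInv Ψ t) →
      MemLipschitzSpace β b → BoundedOrlicz Φ Ψ (fracMaxCommutator α b)) ∧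
    ((∃ C : ℝ≥0, 0 < C ∧ ∀ t : ℝ≥0, 0 < t →
        youngInv Ψ t ≤ C * (youngInv Φ t * (t : ℝ≥0∞) ^ (-((α + β) / (n : ℝ))))) →
      BoundedOrlicz Φ Ψ (fracMaxCommutator α b) → MemLipschitzSpace β b) ∧
    (YoungNablaTwo Φ →
      (∃ C₁ C₂ : ℝ≥0, 0 < C₁ ∧ 0 < C₂ ∧ ∀ t : ℝ≥0, 0 < t →
        C₁ * (youngInv Φ t * (t : ℝ≥0∞) ^ (-((α + β) / (n : ℝ)))) ≤ youngInv Ψ t ∧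
        youngInv Ψ t ≤ C₂ * (youngInv Φ t * (t : ℝ≥0∞) ^ (-((α + β) / (n : ℝ))))) →
      (MemLipschitzSpace β b ↔ BoundedOrlicz Φ Ψ (fracMaxCommutator α b))) := by
  have hn : 0 < n := by
    have : (0 : ℝ) < n := hαβ₀.trans hαβ₁
    exact_mod_cast this
  have part1 : YoungNablaTwo Φ →
      (∃ C : ℝ≥0, 0 < C ∧ ∀ t : ℝ≥0, 0 < t →
        (t : ℝ≥0∞) ^ (-((α + β) / (n : ℝ))) * youngInv Φ t ≤ C * youngInv Ψ t) →
      MemLipschitzSpace β b → BoundedOrlicz Φ Ψ (fracMaxCommutator α b) := by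
    rintro h2 ⟨C, hC0, hC⟩ hbL
    exact boundedOrlicz_fracMaxCommutator hn hβ₀ hαβ₀ hΦ hΨ hΦY h2 hC0 hC hbL
  have part2 : (∃ C : ℝ≥0, 0 < C ∧ ∀ t : ℝ≥0, 0 < t →
        youngInv Ψ t ≤ C * (youngInv Φ t * (t : ℝ≥0∞) ^ (-((α + β) / (n : ℝ))))) →
      BoundedOrlicz Φ Ψ (fracMaxCommutator α b) → MemLipschitzSpace β b := by
    rintro ⟨C, -, hC⟩ ⟨K, hK⟩
    exact memLipschitzSpace_of_oscillation hn hβ₀ hb fun c r hr =>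
      lintegral_oscillation_le hΦ hΨ hC (fun f hf => ⟨(hK f hf).1, (hK f hf).2.2⟩) c hr
  refine ⟨part1, part2, ?_⟩
  rintro h2 ⟨C₁, C₂, hC₁, hC₂, h⟩
  refine ⟨part1 h2 ⟨C₁⁻¹, by positivity, fun t ht => ?_⟩, part2 ⟨C₂, hC₂, fun t ht => (h t ht).2⟩⟩
  calc (t : ℝ≥0∞) ^ (-((α + β) / (n : ℝ))) * youngInv Φ t
      = (C₁⁻¹ : ℝ≥0) * (C₁ * (youngInv Φ t * (t : ℝ≥0∞) ^ (-((α + β) / (n : ℝ))))) := by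
        rw [← mul_assoc, ← ENNReal.coe_mul, inv_mul_cancel₀ hC₁.ne', ENNReal.coe_one, one_mul,
          mul_comm]
    _ ≤ (C₁⁻¹ : ℝ≥0) * youngInv Ψ t := mul_le_mul_right (h t ht).1 _
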